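/- **Proposition 5.1.** Let $\delta>0$, $\alpha\in\mathbb{R}$ and $\beta\in\mathbb{R}\setminus\{0\}$. Put $w_0(0)=w_0(1)=1$ and $w_0(x)=x^{\alpha}(\ln x)^{\beta}$ for integers $x\ge 2$. Let $(p_i)_{i\ge 1}$ be independent random variables on a probability space, where $p_i$ has the $\mathrm{Beta}\big(\frac{w_0(i)}{2\delta},\frac{w_0(i-1)+\delta}{2\delta}\big)$ distribution, and let $S_x=\sum_{i=1}^{x}\ln\frac{1-p_i}{p_i}$ for $x\in\mathbb{N}$. For $\alpha<1$ define $$K(\alpha,\beta,\delta)=\begin{cases}\frac{1-\alpha}{2\delta} & (\alpha<0),\\ \frac{1}{2\delta} & (\alpha=0,\ \beta<0),\\ \frac1\delta & (\alpha=0,\ \beta>0),\\ \frac{1-\alpha}{\delta} & (0<\alpha<1).\end{cases}$$ (i) If $\alpha<0$, then almost surely, for every $\varepsilon\in(0,1/|\beta|)$, $$\liminf_{x\to\infty}\frac{S_x}{x^{1-\alpha-\varepsilon|\beta|}}\ \ge\ \frac{2\delta-\varepsilon/2}{1-\alpha-\varepsilon|\beta|},\qquad \limsup_{x\to\infty}\frac{S_x}{x^{1-\alpha+\varepsilon|\beta|}}\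 \le\ \frac{2\delta+\varepsilon/2}{1-\alpha+\varepsilon|\beta|},$$ where the lower and upper limits are taken in $[-\infty,\infty]$. (ii) If $0\le\alpha<1$, then almost surely $\displaystyle\lim_{x\to\infty}\frac{S_x}{x^{1-\alpha}(\ln x)^{-\beta}}=\frac{1}{K(\alpha,\beta,\delta)}$. (iii) If $\alpha=1$ and $\beta<0$, then almost surely $\displaystyle\lim_{x\to\infty}\frac{S_x}{(\ln x)^{1-\beta}}=\frac{\delta}{1-\beta}$. (iv) If $\alpha=1$ and $0<\beta\le 1$, then almost surely $\displaystyle\lim_{x\to\infty}\frac{S_x}{\ln x}=-1$. -/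

import Mathlib

open Filter Topology MeasureTheory ProbabilityTheory

noncomputable section

/-- The initial weight of the edge `{x, x + 1}`: `1` for `x = 0, 1` and `x ^ α * (ln x) ^ β`
for `x ≥ 2`. -/
def initialWeight (α β : ℝ) (x : ℕ) : ℝ :=
  if x ≤ 1 then 1 else (x : ℝ) ^ α * Real.log x ^ β

/-- The constant `K(α, β, δ)`, meaningful for `α < 1` and `β ≠ 0`. -/
def asympConst (α β δ : ℝ) : ℝ :=
  if α < 0 then (1 - α) / (2 * δ)
  else if α = 0 then (if β < 0 then 1 / (2 * δ) else 1 / δ)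
  else (1 - α) / δ

/-- `p 1, p 2, …` are independent under `P`, and for `i ≥ 1` the law of `p i` is
`Beta (w₀ i / (2 δ), (w₀ (i - 1) + δ) / (2 δ))`. The value `p 0` plays no role. -/
structure IsBetaEnvironment {Ω : Type*} [MeasurableSpace Ω] (P : Measure Ω)
    (w₀ : ℕ → ℝ) (δ : ℝ) (p : ℕ → Ω → ℝ) : Prop where
  indep : iIndepFun (fun i : ℕ => p (i + 1)) P
  law : ∀ i : ℕ,
    HasLaw (p (i + 1)) (betaMeasure (w₀ (i + 1) / (2 * δ)) ((w₀ i + δ) / (2 * δ))) P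

/-- `S_x = ∑_{i = 1}^x ln ((1 - p_i) / p_i)`, the logarithm of the resistance of the edge
`{x, x + 1}` in the environment `p`. -/
def logResistance {Ω : Type*} (p : ℕ → Ω → ℝ) (x : ℕ) (ω : Ω) : ℝ :=
  ∑ i ∈ Finset.Icc 1 x, Real.log ((1 - p i ω) / p i ω)

end

/-! `S_x` is a sum of independent log-odds of beta variables, so two things are needed: a strong law
with a general normalization `B`, and the asymptotics of the expectations. The strong law
(`ae_tendsto_sum_div`) is Kolmogorov's convergence criterion plus Kronecker's lemma; it needs `∑ Var
/ B ^ 2 < ∞`. The mean of the log-odds under Beta(a, b) is `ψ b - ψ a`, with `ψ` the digamma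
function.

If the weights tend to zero, the pole of `ψ` at 0 dominates and the mean increment is about `2 * δ /
w i`. If they tend to infinity, it is `log w (i - 1) - log w i + δ / w i + o(1 / w i)`, so the
expectation of `S_x` is `-log w x` plus roughly `δ * ∑ 1 / w i`. The logarithm is negligible, except
for α = 1, β > 0, where the sum is `o(ln x)` and the logarithm yields the limit -1.

For α < 1 the normalization is `B x = x / w x`, and Stolz–Cesàro reduces everything to `w (i + 1) *
(B (i + 1) - B i) → 1 - α`. For α < 0 this exact limit is stronger than the bounds in (i): a power
`x ^ (ε * |β|)` beats any power of `ln x`. -/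

/-! ### Bounds for the digamma function. -/

/-- The digamma function on the positive reals: the derivative of `log ∘ Γ`. -/
noncomputable def realDigamma (x : ℝ) : ℝ := deriv (Real.log ∘ Real.Gamma) x

lemma hasDerivAt_log_Gamma {x : ℝ} (hx : 0 < x) :
    HasDerivAt (Real.log ∘ Real.Gamma) (realDigamma x) x := by
  have h : DifferentiableAt ℝ Real.Gamma x := Real.differentiableAt_Gamma fun m => by
    have : (0 : ℝ) ≤ m := m.cast_nonneg
    linarith
  exact (h.log (Real.Gamma_pos_of_pos hx).ne').hasDerivAt

lemma log_Gamma_add_one {x : ℝ} (hx : 0 < x) :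
    Real.log (Real.Gamma (x + 1)) = Real.log x + Real.log (Real.Gamma x) := by
  rw [Real.Gamma_add_one hx.ne', Real.log_mul hx.ne' (Real.Gamma_pos_of_pos hx).ne']

lemma realDigamma_add_one {x : ℝ} (hx : 0 < x) : realDigamma (x + 1) = realDigamma x + 1 / x := by
  have h1 : HasDerivAt (fun y => (Real.log ∘ Real.Gamma) (y + 1)) (realDigamma (x + 1)) x :=
    (hasDerivAt_log_Gamma (by linarith : 0 < x + 1)).comp_add_const x 1
  have h2 := (Real.hasDerivAt_log hx.ne').add (hasDerivAt_log_Gamma hx)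
  have h3 : (fun y => (Real.log ∘ Real.Gamma) (y + 1)) =ᶠ[𝓝 x]
      Real.log + (Real.log ∘ Real.Gamma) := by
    filter_upwards [lt_mem_nhds hx] with y hy
    simpa using log_Gamma_add_one hy
  have := (h1.congr_of_eventuallyEq h3.symm).unique h2
  rw [this]; ring

/-- `log ∘ Γ` is convex and its chord over [x, x + 1] has slope `log x`. The tangent slope at the
left end lies below this, and the one at the right end above it, which gives the next lemma. -/
lemma realDigamma_le_log {x : ℝ} (hx : 0 < x) : realDigamma x ≤ Real.log x := by
  have h := Real.convexOn_log_Gamma.le_slope_of_hasDerivAt (Set.mem_Ioi.2 hx)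
    (Set.mem_Ioi.2 (by linarith : 0 < x + 1)) (by linarith) (hasDerivAt_log_Gamma hx)
  simpa [slope_def_field, log_Gamma_add_one hx] using h

lemma log_sub_le_realDigamma {x : ℝ} (hx : 0 < x) : Real.log x - 1 / x ≤ realDigamma x := by
  have h := Real.convexOn_log_Gamma.slope_le_of_hasDerivAt (Set.mem_Ioi.2 hx)
    (Set.mem_Ioi.2 (by linarith : 0 < x + 1)) (by linarith)
    (hasDerivAt_log_Gamma (by linarith : 0 < x + 1))
  rw [realDigamma_add_one hx] at h
  simp [slope_def_field, log_Gamma_add_one hx] at h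
  simp only [one_div]
  linarith

/-- Since `ψ (y + 1) - ψ y = 1 / y`, this turns a bound on `ψ` into an elementary inequality for
one-step differences. -/
lemma nonneg_of_add_one_le_of_tendsto_zero {f : ℝ → ℝ} (hf : ∀ y, 0 < y → f (y + 1) ≤ f y)
    (h0 : Tendsto f atTop (𝓝 0)) {x : ℝ} (hx : 0 < x) : 0 ≤ f x := by
  have h1 : ∀ n : ℕ, f (x + n) ≤ f x := by
    intro n
    induction n with
    | zero => simp
    | succ n ih =>
      have := hf (x + n) (by positivity)
      push_cast
      rw [← add_assoc]
      linarith
  have h2 : Tendsto (fun n : ℕ => f (x + n)) atTop (𝓝 0) :=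
    h0.comp (tendsto_atTop_add_const_left _ _ tendsto_natCast_atTop_atTop)
  exact le_of_tendsto' h2 h1

lemma tendsto_log_sub_realDigamma :
    Tendsto (fun x => Real.log x - realDigamma x) atTop (𝓝 0) := by
  have h : Tendsto (fun x : ℝ => 1 / x) atTop (𝓝 0) := by
    simpa using tendsto_inv_atTop_zero (𝕜 := ℝ)
  refine tendsto_of_tendsto_of_tendsto_of_le_of_le' tendsto_const_nhds h ?_ ?_
  · filter_upwards [eventually_gt_atTop 0] with x hx
    linarith [realDigamma_le_log hx]
  · filter_upwards [eventually_gt_atTop 0] with x hx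
    linarith [log_sub_le_realDigamma hx]

lemma log_add_one_sub_log_ge {y : ℝ} (hy : 0 < y) :
    2 / (2 * y + 1) ≤ Real.log (y + 1) - Real.log y := by
  have h := Real.le_log_one_add_of_nonneg (x := 1 / y) (by positivity)
  rw [← Real.log_div (by positivity) hy.ne']
  have e1 : 1 + 1 / y = (y + 1) / y := by field_simp
  have e2 : 2 * (1 / y) / (1 / y + 2) = 2 / (2 * y + 1) := by field_simp; ring
  rwa [e1, e2] at h

lemma log_add_one_sub_log_le {y : ℝ} (hy : 0 < y) :
    Real.log (y + 1) - Real.log y ≤ (1 / y + 1 / (y + 1)) / 2 := by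
  -- The trapezoid bound is `f u ≥ 0` at `u = (y + 1) / y`; here `f 1 = 0` and `f' u = (1 - 1 / u) ^
  -- 2 / 2`.
  let f : ℝ → ℝ := fun u => (u - 1 / u) / 2 - Real.log u
  have hd : ∀ u : ℝ, 0 < u → HasDerivAt f ((1 + 1 / u ^ 2) / 2 - 1 / u) u := by
    intro u hu
    have h := (((hasDerivAt_id u).sub (hasDerivAt_inv hu.ne')).div_const 2).sub
      (Real.hasDerivAt_log hu.ne')
    have e : (1 + 1 / u ^ 2) / 2 - 1 / u = (1 - -(u ^ 2)⁻¹) / 2 - u⁻¹ := by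
      simp only [one_div]; ring
    rw [e]
    refine h.congr_of_eventuallyEq (Eventually.of_forall fun v => ?_)
    simp [f]
  have hm : MonotoneOn f (Set.Ici 1) := by
    refine monotoneOn_of_deriv_nonneg (convex_Ici 1)
      (fun u hu => (hd u (by have := Set.mem_Ici.1 hu; linarith)).continuousAt.continuousWithinAt)
      (fun u hu => ?_) (fun u hu => ?_) <;> rw [interior_Ici] at hu <;>
      have hu' : (0 : ℝ) < u := lt_trans one_pos hu
    · exact (hd u hu').differentiableAt.differentiableWithinAt
    · rw [(hd u hu').deriv]
      have : (1 + 1 / u ^ 2) / 2 - 1 / u = (1 - 1 / u) ^ 2 / 2 := by field_simp; ring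
      rw [this]; positivity
  have h1 : (1 : ℝ) ≤ (y + 1) / y := by rw [le_div_iff₀ hy]; linarith
  have h := hm (Set.mem_Ici.2 le_rfl) (Set.mem_Ici.2 h1) h1
  simp only [f] at h
  rw [Real.log_div (by positivity) hy.ne'] at h
  have e : ((y + 1) / y - 1 / ((y + 1) / y)) / 2 = (1 / y + 1 / (y + 1)) / 2 := by
    field_simp; ring
  rw [e] at h
  simp at h
  simp only [one_div]
  linarith

lemma realDigamma_le {x : ℝ} (hx : 0 < x) : realDigamma x ≤ Real.log x - 1 / (2 * x) := by
  have h := nonneg_of_add_one_le_of_tendsto_zero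
    (f := fun x => Real.log x - realDigamma x - 1 / (2 * x)) (fun y hy => ?_) ?_ hx
  · linarith
  · have h1 := log_add_one_sub_log_le hy
    have e1 : 1 / (2 * y) = 1 / y / 2 := by field_simp
    have e2 : 1 / (2 * (y + 1)) = 1 / (y + 1) / 2 := by field_simp
    rw [realDigamma_add_one hy, e1, e2]
    linarith
  · have h2 : Tendsto (fun x : ℝ => 1 / (2 * x)) atTop (𝓝 0) := by
      have := (tendsto_inv_atTop_zero (𝕜 := ℝ)).const_mul (1 / 2)
      simpa [mul_comm] using this
    simpa using tendsto_log_sub_realDigamma.sub h2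

/-- Only the order `1 / x ^ 2` of the error matters later. The constant 1/8 is not sharp, but it
makes the one-step defect a visibly positive fraction. -/
lemma le_realDigamma {x : ℝ} (hx : 0 < x) :
    Real.log x - 1 / (2 * x) - 1 / (8 * x ^ 2) ≤ realDigamma x := by
  have h := nonneg_of_add_one_le_of_tendsto_zero
    (f := fun x => 1 / (2 * x) + 1 / (8 * x ^ 2) - (Real.log x - realDigamma x))
    (fun y hy => ?_) ?_ hx
  · linarith
  · have h1 := log_add_one_sub_log_ge hy
    have h2 : 1 / (2 * (y + 1)) + 1 / (8 * (y + 1) ^ 2) + 1 / y - (1 / (2 * y) + 1 / (8 * y ^ 2))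
        ≤ 2 / (2 * y + 1) := by
      have : 2 / (2 * y + 1) - (1 / (2 * (y + 1)) + 1 / (8 * (y + 1) ^ 2) + 1 / y -
          (1 / (2 * y) + 1 / (8 * y ^ 2))) = 1 / (8 * y ^ 2 * (y + 1) ^ 2 * (2 * y + 1)) := by
        field_simp; ring
      have h3 : 0 ≤ 1 / (8 * y ^ 2 * (y + 1) ^ 2 * (2 * y + 1)) := by positivity
      linarith
    rw [realDigamma_add_one hy]
    linarith
  · have h2 : Tendsto (fun x : ℝ => 1 / (2 * x)) atTop (𝓝 0) := by
      have := (tendsto_inv_atTop_zero (𝕜 := ℝ)).const_mul (1 / 2)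
      simpa [mul_comm] using this
    have h3 : Tendsto (fun x : ℝ => 1 / (8 * x ^ 2)) atTop (𝓝 0) := by
      have := ((tendsto_inv_atTop_zero (𝕜 := ℝ)).pow 2).const_mul (1 / 8)
      simpa [mul_comm] using this
    simpa using (h2.add h3).sub tendsto_log_sub_realDigamma

/-! ### Log-odds of a beta variable: exponential moments, mean, variance. -/

/-- The logarithm of the odds `(1 - x) / x`. -/
noncomputable def logOdds (x : ℝ) : ℝ := Real.log ((1 - x) / x)

@[fun_prop]
lemma measurable_logOdds : Measurable logOdds := by
  unfold logOdds; fun_prop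

/-- Tilting the Beta(a, b) density by `((1 - x) / x) ^ t` gives a multiple of the Beta(a - t, b + t)
density. -/
lemma lintegral_exp_logOdds {a b t : ℝ} (hta : t < a) (htb : -b < t) (ha : 0 < a) (hb : 0 < b) :
    ∫⁻ x, ENNReal.ofReal (Real.exp (t * logOdds x)) ∂(betaMeasure a b) =
      ENNReal.ofReal (beta (a - t) (b + t) / beta a b) := by
  have hb1 := beta_pos ha hb
  have hb2 := beta_pos (sub_pos.2 hta) (by linarith : 0 < b + t)
  rw [betaMeasure, lintegral_withDensity_eq_lintegral_mul _
    (by unfold betaPDF; fun_prop) (by fun_prop)]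
  have key : ∀ x, (betaPDF a b * fun x => ENNReal.ofReal (Real.exp (t * logOdds x))) x =
      ENNReal.ofReal (beta (a - t) (b + t) / beta a b) * betaPDF (a - t) (b + t) x := by
    intro x
    by_cases hx : 0 < x ∧ x < 1
    · obtain ⟨h0, h1⟩ := hx
      have h1' : 0 < 1 - x := sub_pos.2 h1
      rw [Pi.mul_apply, betaPDF_of_pos_lt_one h0 h1, betaPDF_of_pos_lt_one h0 h1,
        ← ENNReal.ofReal_mul (by positivity), ← ENNReal.ofReal_mul (by positivity)]
      congr 1
      have e : Real.exp (t * logOdds x) = (1 - x) ^ t * x ^ (-t) := by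
        rw [logOdds, Real.log_div h1'.ne' h0.ne', Real.rpow_def_of_pos h0, Real.rpow_def_of_pos h1',
          ← Real.exp_add]
        congr 1; ring
      have e1 : x ^ (a - t - 1) = x ^ (a - 1) * x ^ (-t) := by
        rw [← Real.rpow_add h0]; congr 1; ring
      have e2 : (1 - x) ^ (b + t - 1) = (1 - x) ^ (b - 1) * (1 - x) ^ t := by
        rw [← Real.rpow_add h1']; congr 1; ring
      rw [e, e1, e2]
      field_simp
    · have : ∀ c d, betaPDF c d x = 0 := by intro c d; rw [betaPDF_eq, if_neg hx]; simp
      simp [this]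
  simp_rw [key]
  rw [lintegral_const_mul _ (by unfold betaPDF; fun_prop),
    lintegral_betaPDF_eq_one (sub_pos.2 hta) (by linarith), mul_one]

lemma integrable_exp_logOdds {a b t : ℝ} (hta : t < a) (htb : -b < t) (ha : 0 < a) (hb : 0 < b) :
    Integrable (fun x => Real.exp (t * logOdds x)) (betaMeasure a b) := by
  refine ⟨by fun_prop, ?_⟩
  rw [hasFiniteIntegral_iff_ofReal (ae_of_all _ fun x => (Real.exp_pos _).le),
    lintegral_exp_logOdds hta htb ha hb]
  exact ENNReal.ofReal_lt_top

lemma mgf_logOdds {a b t : ℝ} (hta : t < a) (htb : -b < t) (ha : 0 < a) (hb : 0 < b) :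
    mgf logOdds (betaMeasure a b) t = beta (a - t) (b + t) / beta a b := by
  have hb1 := beta_pos ha hb
  have hb2 := beta_pos (sub_pos.2 hta) (by linarith : 0 < b + t)
  rw [mgf, integral_eq_lintegral_of_nonneg_ae (ae_of_all _ fun x => (Real.exp_pos _).le)
    (by fun_prop), lintegral_exp_logOdds hta htb ha hb, ENNReal.toReal_ofReal (by positivity)]

lemma zero_mem_interior_integrableExpSet_logOdds {a b : ℝ} (ha : 0 < a) (hb : 0 < b) :
    0 ∈ interior (integrableExpSet logOdds (betaMeasure a b)) := by
  refine interior_mono (s := Set.Ioo (-b) a)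
    (fun t ht => integrable_exp_logOdds ht.2 ht.1 ha hb) ?_
  rw [interior_Ioo]
  exact ⟨by linarith, ha⟩

lemma memLp_logOdds {a b : ℝ} (ha : 0 < a) (hb : 0 < b) :
    MemLp logOdds 2 (betaMeasure a b) :=
  memLp_of_mem_interior_integrableExpSet (zero_mem_interior_integrableExpSet_logOdds ha hb) 2

/-- The mean is the derivative at 0 of the cumulant generating function. The parameters `a - t` and
`b + t` have constant sum, so only two Gamma factors depend on `t`. -/
lemma integral_logOdds {a b : ℝ} (ha : 0 < a) (hb : 0 < b) :
    ∫ x, logOdds x ∂(betaMeasure a b) = realDigamma b - realDigamma a := by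
  have := isProbabilityMeasureBeta ha hb
  have h0 := deriv_cgf_zero (zero_mem_interior_integrableExpSet_logOdds ha hb)
  rw [probReal_univ, div_one] at h0
  rw [← h0]
  have h1 : HasDerivAt (fun t => (Real.log ∘ Real.Gamma) (a - t)) (-realDigamma a) 0 := by
    simpa using (show HasDerivAt (Real.log ∘ Real.Gamma) (realDigamma a) (a - 0) by
      simpa using hasDerivAt_log_Gamma ha).comp_const_sub a 0
  have h2 : HasDerivAt (fun t => (Real.log ∘ Real.Gamma) (b + t)) (realDigamma b) 0 := by
    simpa using (show HasDerivAt (Real.log ∘ Real.Gamma) (realDigamma b) (b + 0) by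
      simpa using hasDerivAt_log_Gamma hb).comp_const_add b 0
  have h3 := ((h1.add h2).sub_const (Real.log (Real.Gamma a * Real.Gamma b)))
  have h4 : cgf logOdds (betaMeasure a b) =ᶠ[𝓝 0] fun t => (Real.log ∘ Real.Gamma) (a - t) +
      (Real.log ∘ Real.Gamma) (b + t) - Real.log (Real.Gamma a * Real.Gamma b) := by
    filter_upwards [Ioo_mem_nhds (by linarith : -b < 0) ha] with t ht
    have g1 := Real.Gamma_pos_of_pos (sub_pos.2 ht.2)
    have g2 := Real.Gamma_pos_of_pos (by linarith [ht.1] : 0 < b + t)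
    have g3 := Real.Gamma_pos_of_pos ha
    have g4 := Real.Gamma_pos_of_pos hb
    have g5 := Real.Gamma_pos_of_pos (add_pos ha hb)
    rw [cgf, mgf_logOdds ht.2 ht.1 ha hb, beta, beta, show a - t + (b + t) = a + b by ring,
      div_div_div_cancel_right₀ g5.ne', Real.log_div (by positivity) (by positivity),
      Real.log_mul g1.ne' g2.ne']
    rfl
  rw [(h3.congr_of_eventuallyEq h4).deriv]
  ring

lemma sq_le_exp_add_exp_neg (u : ℝ) : u ^ 2 ≤ 2 * (Real.exp u + Real.exp (-u) - 2) := by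
  rcases le_total 0 u with h | h
  · nlinarith [Real.quadratic_le_exp_of_nonneg h, Real.add_one_le_exp (-u)]
  · nlinarith [Real.quadratic_le_exp_of_nonneg (neg_nonneg.2 h), Real.add_one_le_exp u]

lemma variance_le_integral_sq_sub {Ω : Type*} [MeasurableSpace Ω] {P : Measure Ω}
    [IsProbabilityMeasure P] {X : Ω → ℝ} (hX : MemLp X 2 P) (c : ℝ) :
    Var[X; P] ≤ ∫ ω, (X ω - c) ^ 2 ∂P := by
  rw [← variance_sub_const hX.aestronglyMeasurable c]
  exact variance_le_expectation_sq (hX.aestronglyMeasurable.sub aestronglyMeasurable_const)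

/-- Bounding a square by a hyperbolic cosine controls the variance by two explicit exponential
moments. The scale `s` and the centre `c` stay free, to suit large and small parameters. -/
lemma sq_mul_variance_logOdds_le {a b s : ℝ} (hs : 0 < s) (ha : s < a) (hb : s < b) (c : ℝ) :
    s ^ 2 * Var[logOdds; betaMeasure a b] ≤
      2 * (Real.exp (-(s * c)) * (beta (a - s) (b + s) / beta a b) +
        Real.exp (s * c) * (beta (a + s) (b - s) / beta a b) - 2) := by
  have ha0 := hs.trans ha
  have hb0 := hs.trans hb
  have := isProbabilityMeasureBeta ha0 hb0
  have hM := memLp_logOdds ha0 hb0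
  have i1 := integrable_exp_logOdds ha (by linarith : -b < s) ha0 hb0
  have i2 := integrable_exp_logOdds (by linarith : -s < a) (by linarith : -b < -s) ha0 hb0
  have m1 := mgf_logOdds ha (by linarith : -b < s) ha0 hb0
  have m2 := mgf_logOdds (by linarith : -s < a) (by linarith : -b < -s) ha0 hb0
  rw [sub_neg_eq_add, ← sub_eq_add_neg] at m2
  rw [← m1, ← m2, mgf, mgf, ← integral_const_mul, ← integral_const_mul]
  have j1 := i1.const_mul (Real.exp (-(s * c)))
  have j2 := i2.const_mul (Real.exp (s * c))
  have e : ∫ x, (Real.exp (-(s * c)) * Real.exp (s * logOdds x)) ∂(betaMeasure a b) +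
      ∫ x, (Real.exp (s * c) * Real.exp (-s * logOdds x)) ∂(betaMeasure a b) - 2 =
      ∫ x, (Real.exp (-(s * c)) * Real.exp (s * logOdds x) +
        Real.exp (s * c) * Real.exp (-s * logOdds x) - 2) ∂(betaMeasure a b) := by
    rw [← integral_add j1 j2]
    refine Eq.trans ?_ (integral_sub (j1.add j2) (integrable_const 2)).symm
    simp
  rw [e, ← integral_const_mul]
  calc s ^ 2 * Var[logOdds; betaMeasure a b]
      ≤ s ^ 2 * ∫ x, (logOdds x - c) ^ 2 ∂(betaMeasure a b) := by
        gcongr; exact variance_le_integral_sq_sub hM c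
    _ = ∫ x, s ^ 2 * (logOdds x - c) ^ 2 ∂(betaMeasure a b) := by rw [integral_const_mul]
    _ ≤ _ := by
        refine integral_mono (((hM.sub (memLp_const c)).integrable_sq).const_mul _)
          (((j1.add j2).sub (integrable_const _)).const_mul _) fun x => ?_
        have h := sq_le_exp_add_exp_neg (s * (logOdds x - c))
        have e1 : s * (logOdds x - c) = -(s * c) + s * logOdds x := by ring
        have e2 : -(-(s * c) + s * logOdds x) = s * c + -s * logOdds x := by ring
        have e3 : s ^ 2 * (logOdds x - c) ^ 2 = (s * (logOdds x - c)) ^ 2 := by ring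
        simp only
        rw [← Real.exp_add, ← Real.exp_add, e3]
        rw [e1, e2] at h
        rwa [e1]

lemma variance_logOdds_le_of_one_lt {a b : ℝ} (ha : 1 < a) (hb : 1 < b) :
    Var[logOdds; betaMeasure a b] ≤ 2 * (1 / (a - 1) + 1 / (b - 1)) := by
  -- A shift by 1 makes the Gamma ratios rational. This centre turns the two terms into `a / (a -
  -- 1)` and `b / (b - 1)`.
  have h := sq_mul_variance_logOdds_le one_pos ha hb (Real.log (b / a))
  have ha0 : 0 < a := by linarith
  have hb0 : 0 < b := by linarith
  have ha1 : 0 < a - 1 := by linarith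
  have hb1 : 0 < b - 1 := by linarith
  have g1 := Real.Gamma_pos_of_pos ha0
  have g2 := Real.Gamma_pos_of_pos hb0
  have g3 := Real.Gamma_pos_of_pos ha1
  have g4 := Real.Gamma_pos_of_pos hb1
  have g5 := Real.Gamma_pos_of_pos (add_pos ha0 hb0)
  have e1 : Real.Gamma a = (a - 1) * Real.Gamma (a - 1) := by
    rw [← Real.Gamma_add_one ha1.ne']; simp
  have e2 : Real.Gamma b = (b - 1) * Real.Gamma (b - 1) := by
    rw [← Real.Gamma_add_one hb1.ne']; simp
  have r1 : beta (a - 1) (b + 1) / beta a b = b / (a - 1) := by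
    rw [beta, beta, show a - 1 + (b + 1) = a + b by ring, Real.Gamma_add_one hb0.ne', e1]
    field_simp
  have r2 : beta (a + 1) (b - 1) / beta a b = a / (b - 1) := by
    rw [beta, beta, show a + 1 + (b - 1) = a + b by ring, Real.Gamma_add_one ha0.ne', e2]
    field_simp
  rw [r1, r2, one_mul, Real.exp_neg, Real.exp_log (by positivity)] at h
  refine (le_of_eq (by ring)).trans (h.trans (le_of_eq ?_))
  field_simp
  ring

/-- Exponential moments exist only below `a i → 0`, hence the scale `s = a i / 2`. As `Γ(a/2) / Γ(a)
→ 2` and `Γ(3a/2) / Γ(a) → 2/3`, the bound on `s ^ 2 * Var` tends to `2 * (2 + 2/3 - 2) = 4/3 < 2`;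
multiplying by 4 gives 8. -/
lemma eventually_sq_mul_variance_logOdds_le {a b : ℕ → ℝ} {c : ℝ} (hc : 0 < c)
    (ha : ∀ i, 0 < a i) (ha0 : Tendsto a atTop (𝓝 0)) (hb : Tendsto b atTop (𝓝 c)) :
    ∀ᶠ i in atTop, a i ^ 2 * Var[logOdds; betaMeasure (a i) (b i)] ≤ 8 := by
  have hG : ∀ {x : ℝ}, 0 < x → ContinuousAt Real.Gamma x := fun {x} hx =>
    (Real.differentiableAt_Gamma fun m => by
      have : (0 : ℝ) ≤ m := m.cast_nonneg
      linarith).continuousAt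
  have t1 : Tendsto (fun i => Real.Gamma (a i / 2 + 1)) atTop (𝓝 1) := by
    have h : Tendsto (fun i => a i / 2 + 1) atTop (𝓝 1) := by
      simpa using (ha0.div_const 2).add_const 1
    simpa [Function.comp_def] using (hG one_pos).tendsto.comp h
  have t2 : Tendsto (fun i => Real.Gamma (3 * a i / 2 + 1)) atTop (𝓝 1) := by
    have h : Tendsto (fun i => 3 * a i / 2 + 1) atTop (𝓝 1) := by
      simpa using ((ha0.const_mul 3).div_const 2).add_const 1
    simpa [Function.comp_def] using (hG one_pos).tendsto.comp h
  have t3 : Tendsto (fun i => Real.Gamma (a i + 1)) atTop (𝓝 1) := by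
    have h : Tendsto (fun i => a i + 1) atTop (𝓝 1) := by
      simpa using ha0.add_const 1
    simpa [Function.comp_def] using (hG one_pos).tendsto.comp h
  have t4 : Tendsto (fun i => Real.Gamma (b i)) atTop (𝓝 (Real.Gamma c)) :=
    (hG hc).tendsto.comp hb
  have t5 : Tendsto (fun i => Real.Gamma (b i + a i / 2)) atTop (𝓝 (Real.Gamma c)) :=
    (hG hc).tendsto.comp (by simpa using hb.add (ha0.div_const 2))
  have t6 : Tendsto (fun i => Real.Gamma (b i - a i / 2)) atTop (𝓝 (Real.Gamma c)) :=
    (hG hc).tendsto.comp (by simpa using hb.sub (ha0.div_const 2))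
  have hg := (Real.Gamma_pos_of_pos hc).ne'
  have T : Tendsto (fun i => 2 * (2 * (Real.Gamma (a i / 2 + 1) * Real.Gamma (b i + a i / 2) /
      (Real.Gamma (a i + 1) * Real.Gamma (b i))) + 2 / 3 * (Real.Gamma (3 * a i / 2 + 1) *
      Real.Gamma (b i - a i / 2) / (Real.Gamma (a i + 1) * Real.Gamma (b i))) - 2))
      atTop (𝓝 (4 / 3)) := by
    have h := (((((t1.mul t5).div (t3.mul t4) (by simpa using hg)).const_mul 2).add
      (((t2.mul t6).div (t3.mul t4) (by simpa using hg)).const_mul (2 / 3))).sub_const 2).const_mul 2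
    have e : (2 : ℝ) * (2 * (1 * Real.Gamma c / (1 * Real.Gamma c)) +
        2 / 3 * (1 * Real.Gamma c / (1 * Real.Gamma c)) - 2) = 4 / 3 := by
      field_simp; norm_num
    rw [← e]
    exact h
  have hab : ∀ᶠ i in atTop, a i / 2 < b i :=
    (show Tendsto (fun i => a i / 2) atTop (𝓝 0) by simpa using ha0.div_const 2).eventually_lt hb hc
  filter_upwards [hab, T.eventually_le_const (show (4 / 3 : ℝ) < 2 by norm_num)] with i hi hT
  have hai := ha i
  have h := sq_mul_variance_logOdds_le (half_pos hai) (half_lt_self hai) hi 0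
  have hb0 : 0 < b i := (half_pos hai).trans hi
  have g1 := Real.Gamma_pos_of_pos hai
  have g2 := Real.Gamma_pos_of_pos hb0
  have g5 := Real.Gamma_pos_of_pos (add_pos hai hb0)
  have r1 : beta (a i - a i / 2) (b i + a i / 2) / beta (a i) (b i) =
      2 * (Real.Gamma (a i / 2 + 1) * Real.Gamma (b i + a i / 2) /
      (Real.Gamma (a i + 1) * Real.Gamma (b i))) := by
    rw [beta, beta, show a i - a i / 2 + (b i + a i / 2) = a i + b i by ring,
      Real.Gamma_add_one hai.ne', Real.Gamma_add_one (half_pos hai).ne', sub_half]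
    field_simp
  have r2 : beta (a i + a i / 2) (b i - a i / 2) / beta (a i) (b i) =
      2 / 3 * (Real.Gamma (3 * a i / 2 + 1) *
      Real.Gamma (b i - a i / 2) / (Real.Gamma (a i + 1) * Real.Gamma (b i))) := by
    rw [beta, beta, show a i + a i / 2 + (b i - a i / 2) = a i + b i by ring,
      show a i + a i / 2 = 3 * a i / 2 by ring, Real.Gamma_add_one hai.ne',
      Real.Gamma_add_one (by positivity)]
    field_simp
  rw [r1, r2] at h
  simp only [mul_zero, neg_zero, Real.exp_zero, one_mul] at h
  nlinarith

/-! ### Stolz–Cesàro and Kronecker. -/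

lemma sum_range_div_tendsto {f B : ℕ → ℝ} {L : ℝ} (hB : Tendsto B atTop atTop)
    (hD : ∀ᶠ i in atTop, 0 < B (i + 1) - B i)
    (h : Tendsto (fun i => f i / (B (i + 1) - B i)) atTop (𝓝 L)) :
    Tendsto (fun n => (∑ i ∈ Finset.range n, f i) / B n) atTop (𝓝 L) := by
  obtain ⟨N, hN⟩ := eventually_atTop.1 hD
  set D : ℕ → ℝ := fun i => B (i + 1) - B i
  -- The increments are positive only from `N` on. Absolute values make them nonnegative everywhere,
  -- at the cost of a constant `c` that vanishes after division by `B n`.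
  set c : ℝ := ∑ i ∈ Finset.range N, |D i| - B N with hc
  have hs : ∀ n, N ≤ n → ∑ i ∈ Finset.range n, |D i| = B n + c := by
    intro n hn
    induction n, hn using Nat.le_induction with
    | base => rw [hc]; ring
    | succ n hn ih => rw [Finset.sum_range_succ, ih, abs_of_pos (hN n hn)]; ring
  have hs' : (fun n => B n + c) =ᶠ[atTop] fun n => ∑ i ∈ Finset.range n, |D i| := by
    filter_upwards [eventually_ge_atTop N] with n hn using (hs n hn).symm
  have hT : Tendsto (fun n => ∑ i ∈ Finset.range n, |D i|) atTop atTop :=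
    (tendsto_atTop_add_const_right _ c hB).congr' hs'
  have ho : (fun i => f i - L * D i) =o[atTop] fun i => |D i| := by
    rw [Asymptotics.isLittleO_iff_tendsto' (by
      filter_upwards [hD] with i hi h0
      exact absurd (abs_eq_zero.1 h0) hi.ne')]
    have := h.sub_const L
    rw [sub_self] at this
    refine this.congr' ?_
    filter_upwards [hD] with i hi
    change 0 < D i at hi
    rw [abs_of_pos hi]
    change (f i / D i - L) = _
    field_simp
  have h1 := (ho.sum_range (fun i => abs_nonneg _) hT).tendsto_div_nhds_zero
  have hBpos : ∀ᶠ n in atTop, 0 < B n := hB.eventually_gt_atTop 0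
  have hcB : Tendsto (fun n => c / B n) atTop (𝓝 0) := hB.const_div_atTop c
  have h2 : Tendsto (fun n => (∑ i ∈ Finset.range n, |D i|) / B n) atTop (𝓝 1) := by
    have : Tendsto (fun n => 1 + c / B n) atTop (𝓝 1) := by simpa using hcB.const_add 1
    refine this.congr' ?_
    filter_upwards [hs', hBpos] with n hn hp
    rw [← hn]; field_simp
  have h3 := h1.mul h2
  have h4 : Tendsto (fun n => L * (1 - B 0 / B n)) atTop (𝓝 L) := by
    simpa using ((hB.const_div_atTop (B 0)).const_sub 1).const_mul L
  have h5 := h3.add h4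
  rw [zero_mul, zero_add] at h5
  refine h5.congr' ?_
  filter_upwards [hBpos, hT.eventually_gt_atTop 0] with n hp hp2
  rw [div_mul_div_cancel₀ hp2.ne', Finset.sum_sub_distrib, ← Finset.mul_sum,
    Finset.sum_range_sub]
  field_simp
  ring

/-- **Kronecker's lemma**. -/
lemma kronecker_tendsto {x b : ℕ → ℝ} {c : ℝ} (hb0 : ∀ n, 0 < b n) (hb : Monotone b)
    (hbt : Tendsto b atTop atTop)
    (h : Tendsto (fun n => ∑ i ∈ Finset.range n, x i / b (i + 1)) atTop (𝓝 c)) :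
    Tendsto (fun n => (∑ i ∈ Finset.range n, x i) / b n) atTop (𝓝 0) := by
  set T : ℕ → ℝ := fun n => ∑ i ∈ Finset.range n, x i / b (i + 1) with hTdef
  -- Abel summation; afterwards `T i` is compared with its limit `c`.
  have habel : ∀ n, ∑ i ∈ Finset.range n, x i =
      b n * T n - ∑ i ∈ Finset.range n, (b (i + 1) - b i) * T i := by
    intro n
    induction n with
    | zero => simp [hTdef]
    | succ n ih =>
      have : T (n + 1) = T n + x n / b (n + 1) := by simp [hTdef, Finset.sum_range_succ]
      have hn := (hb0 (n + 1)).ne'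
      rw [Finset.sum_range_succ, Finset.sum_range_succ, ih, this]
      field_simp
      ring
  have ho : (fun i => (b (i + 1) - b i) * (T i - c)) =o[atTop] fun i => b (i + 1) - b i := by
    have := (Asymptotics.isBigO_refl (fun i => b (i + 1) - b i) atTop).mul_isLittleO
      ((Asymptotics.isLittleO_one_iff ℝ).2 (tendsto_sub_nhds_zero_iff.2 h))
    simpa using this
  have hsum : ∀ n, ∑ i ∈ Finset.range n, (b (i + 1) - b i) = b n - b 0 :=
    fun n => Finset.sum_range_sub b n
  have hb' : Tendsto (fun n => ∑ i ∈ Finset.range n, (b (i + 1) - b i)) atTop atTop := by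
    simp_rw [hsum]
    exact tendsto_atTop_add_const_right _ _ hbt
  have h1 := ho.sum_range (fun i => sub_nonneg.2 (hb i.le_succ)) hb'
  simp_rw [hsum] at h1
  have h2 : (fun n => b n - b 0) =O[atTop] b := by
    refine Asymptotics.IsBigO.of_bound 1 (Eventually.of_forall fun n => ?_)
    have := hb n.zero_le
    rw [Real.norm_of_nonneg (by linarith), Real.norm_of_nonneg (hb0 n).le]
    linarith [hb0 0]
  have h3 := (h1.trans_isBigO h2).tendsto_div_nhds_zero
  have h4 : Tendsto (fun n => T n - c + c * (b 0 / b n) -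
      (∑ i ∈ Finset.range n, (b (i + 1) - b i) * (T i - c)) / b n) atTop (𝓝 0) := by
    have := ((tendsto_sub_nhds_zero_iff.2 h).add
      ((hbt.const_div_atTop (b 0)).const_mul c)).sub h3
    simpa using this
  refine h4.congr fun n => ?_
  have hn := (hb0 n).ne'
  have e : ∑ i ∈ Finset.range n, (b (i + 1) - b i) * (T i - c) =
      ∑ i ∈ Finset.range n, (b (i + 1) - b i) * T i - c * (b n - b 0) := by
    rw [← hsum, Finset.mul_sum, ← Finset.sum_sub_distrib]
    exact Finset.sum_congr rfl fun i _ => by ring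
  rw [habel, e]
  field_simp
  ring

/-! ### Strong law with a general normalization. -/

/-- Kolmogorov's convergence criterion, for measurable summands. -/
lemma ae_exists_tendsto_sum_of_stronglyMeasurable {Ω : Type*} [MeasurableSpace Ω] {P : Measure Ω}
    [IsProbabilityMeasure P] {Y : ℕ → Ω → ℝ} (hm : ∀ i, StronglyMeasurable (Y i))
    (hY : ∀ i, MemLp (Y i) 2 P) (hind : iIndepFun Y P) (h0 : ∀ i, ∫ ω, Y i ω ∂P = 0)
    (hs : Summable fun i => Var[Y i; P]) :
    ∀ᵐ ω ∂P, ∃ c, Tendsto (fun n => ∑ i ∈ Finset.range n, Y i ω) atTop (𝓝 c) := by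
  let F := Filtration.natural Y hm
  -- The range `n + 1` makes `S n` adapted to the σ-algebra of `Y 0, …, Y n`. This martingale is
  -- bounded in L², hence in L¹, so it converges almost surely.
  let S : ℕ → Ω → ℝ := fun n => ∑ i ∈ Finset.range (n + 1), Y i
  have hSL : ∀ n, MemLp (S n) 2 P := fun n => memLp_finsetSum' _ fun i _ => hY i
  have hadapt : StronglyAdapted F S := fun n =>
    Finset.stronglyMeasurable_sum _ fun i hi =>
      (Filtration.stronglyAdapted_natural hm i).mono
        (F.mono (Nat.lt_succ_iff.1 (Finset.mem_range.1 hi)))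
  have hmart : Martingale S F P := by
    refine martingale_of_condExp_sub_eq_zero_nat hadapt
      (fun n => (hSL n).integrable one_le_two) fun n => ?_
    have e : S (n + 1) - S n = Y (n + 1) := by
      simp only [S]
      rw [Finset.sum_range_succ _ (n + 1)]
      simp
    rw [e]
    refine (hind.condExp_natural_ae_eq_of_lt hm n.lt_succ_self).trans ?_
    rw [h0]
    rfl
  have hbd : ∀ n, eLpNorm (S n) 1 P ≤ (Real.sqrt (∑' i, Var[Y i; P])).toNNReal := by
    intro n
    refine (eLpNorm_le_eLpNorm_of_exponent_le one_le_two
      (hSL n).aestronglyMeasurable).trans ?_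
    have hmean : ∫ ω, S n ω ∂P = 0 := by
      simp only [S, Finset.sum_apply]
      rw [integral_finsetSum _ fun i _ => (hY i).integrable one_le_two]
      simp [h0]
    have hvar : Var[S n; P] ≤ ∑' i, Var[Y i; P] := by
      simp only [S]
      rw [IndepFun.variance_sum (fun i _ => hY i) fun i _ j _ hij => hind.indepFun hij]
      exact hs.sum_le_tsum _ fun i _ => variance_nonneg _ _
    rw [variance_of_integral_eq_zero (hSL n).aestronglyMeasurable.aemeasurable hmean] at hvar
    rw [(hSL n).eLpNorm_eq_integral_rpow_norm two_ne_zero ENNReal.ofNat_ne_top]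
    refine ENNReal.ofReal_le_ofReal ?_
    rw [Real.sqrt_eq_rpow]
    simp only [ENNReal.toReal_ofNat, one_div]
    refine Real.rpow_le_rpow (by positivity) ?_ (by positivity)
    simpa using hvar
  filter_upwards [hmart.submartingale.exists_ae_tendsto_of_bdd hbd] with ω ⟨c, hc⟩
  refine ⟨c, (tendsto_add_atTop_iff_nat 1).1 ?_⟩
  simpa [S] using hc

/-- **Kolmogorov's convergence criterion**. -/
lemma ae_exists_tendsto_sum_of_summable_variance {Ω : Type*} [MeasurableSpace Ω] {P : Measure Ω}
    [IsProbabilityMeasure P] {Y : ℕ → Ω → ℝ}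
    (hY : ∀ i, MemLp (Y i) 2 P) (hind : iIndepFun Y P) (h0 : ∀ i, ∫ ω, Y i ω ∂P = 0)
    (hs : Summable fun i => Var[Y i; P]) :
    ∀ᵐ ω ∂P, ∃ c, Tendsto (fun n => ∑ i ∈ Finset.range n, Y i ω) atTop (𝓝 c) := by
  let Z : ℕ → Ω → ℝ := fun i => (hY i).aestronglyMeasurable.mk (Y i)
  have hYZ : ∀ i, Y i =ᵐ[P] Z i := fun i => (hY i).aestronglyMeasurable.ae_eq_mk
  have h := ae_exists_tendsto_sum_of_stronglyMeasurable (Y := Z)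
    (fun i => (hY i).aestronglyMeasurable.stronglyMeasurable_mk)
    (fun i => (memLp_congr_ae (hYZ i)).1 (hY i)) (hind.congr hYZ)
    (fun i => (integral_congr_ae (hYZ i)).symm.trans (h0 i))
    (by simpa only [← variance_congr (hYZ _)] using hs)
  filter_upwards [h, ae_all_iff.2 hYZ] with ω hω heq
  simpa only [heq] using hω

/-- A strong law of large numbers for independent variables with a general normalization. -/
lemma ae_tendsto_sum_div {Ω : Type*} [MeasurableSpace Ω] {P : Measure Ω}
    [IsProbabilityMeasure P] {X : ℕ → Ω → ℝ} {B : ℕ → ℝ} {L : ℝ}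
    (hX : ∀ i, MemLp (X i) 2 P) (hind : iIndepFun X P) (hBt : Tendsto B atTop atTop)
    (hB : ∀ᶠ i in atTop, B i ≤ B (i + 1))
    (hs : Summable fun i => Var[X i; P] / B (i + 1) ^ 2)
    (hmean : Tendsto (fun n => (∑ i ∈ Finset.range n, ∫ ω, X i ω ∂P) / B n) atTop (𝓝 L)) :
    ∀ᵐ ω ∂P, Tendsto (fun n => (∑ i ∈ Finset.range n, X i ω) / B n) atTop (𝓝 L) := by
  obtain ⟨N, hN⟩ := eventually_atTop.1 (hB.and (hBt.eventually_gt_atTop 0))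
  -- Freezing `B` below `N` makes it positive and monotone everywhere, without affecting limits or
  -- summability.
  let b : ℕ → ℝ := fun n => B (max n N)
  have hbm : Monotone b := monotone_nat_of_le_succ fun n => by
    rcases le_or_gt N n with h | h
    · simp only [b, max_eq_left h, max_eq_left (h.trans n.le_succ)]
      exact (hN n h).1
    · simp only [b, max_eq_right h.le, max_eq_right (Nat.succ_le_of_lt h)]
      exact le_rfl
  have hbB : ∀ n, N ≤ n → b n = B n := fun n hn => by simp only [b, max_eq_left hn]
  have hbe : B =ᶠ[atTop] b := by
    filter_upwards [eventually_ge_atTop N] with n hn using (hbB n hn).symm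
  have hb0 : ∀ n, 0 < b n := fun n => (hN _ (le_max_right _ _)).2
  have hbt : Tendsto b atTop atTop := hBt.congr' hbe
  let Y : ℕ → Ω → ℝ := fun i ω => (X i ω - ∫ ω, X i ω ∂P) / b (i + 1)
  have hYL : ∀ i, MemLp (Y i) 2 P := fun i => by
    have := ((hX i).sub (memLp_const (∫ ω, X i ω ∂P))).mul_const (b (i + 1))⁻¹
    simpa only [Y, div_eq_mul_inv, Pi.sub_apply] using this
  have hYi : iIndepFun Y P :=
    hind.comp (fun i x => (x - ∫ ω, X i ω ∂P) / b (i + 1)) fun i => by fun_prop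
  have hY0 : ∀ i, ∫ ω, Y i ω ∂P = 0 := fun i => by
    simp only [Y]
    rw [integral_div, integral_sub ((hX i).integrable one_le_two) (integrable_const _)]
    simp
  have hYv : ∀ i, Var[Y i; P] = Var[X i; P] / b (i + 1) ^ 2 := fun i => by
    have : Y i = fun ω => (b (i + 1))⁻¹ * (X i ω - ∫ ω, X i ω ∂P) := by
      funext ω; simp only [Y]; ring
    rw [this, variance_const_mul, variance_sub_const (hX i).aestronglyMeasurable]
    field_simp
  have hYs : Summable fun i => Var[Y i; P] := by
    refine (summable_congr_atTop ?_).1 hs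
    filter_upwards [eventually_ge_atTop N] with i hi
    rw [hYv, hbB _ (hi.trans i.le_succ)]
  filter_upwards [ae_exists_tendsto_sum_of_summable_variance hYL hYi hY0 hYs] with ω ⟨c, hc⟩
  have h := kronecker_tendsto hb0 hbm hbt hc
  have h2 := (h.congr' (f₂ := fun n => (∑ i ∈ Finset.range n, (X i ω - ∫ ω, X i ω ∂P)) / B n)
    (by filter_upwards [hbe] with n hn; rw [hn])).add hmean
  rw [zero_add] at h2
  refine h2.congr fun n => ?_
  rw [← add_div, Finset.sum_sub_distrib, sub_add_cancel]

/-! ### Moments in the beta environment. -/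

lemma logResistance_eq_sum_range {Ω : Type*} [MeasurableSpace Ω] (p : ℕ → Ω → ℝ) (n : ℕ) (ω : Ω) :
    logResistance p n ω = ∑ i ∈ Finset.range n, logOdds (p (i + 1) ω) := by
  rw [logResistance, Finset.range_eq_Ico, Finset.sum_Ico_add' (fun i => logOdds (p i ω)) 0 n 1]
  rfl

section Environment

variable {Ω : Type*} [MeasurableSpace Ω] {P : Measure Ω} {w : ℕ → ℝ} {δ : ℝ} {p : ℕ → Ω → ℝ}

lemma IsBetaEnvironment.iIndepFun_logOdds (hp : IsBetaEnvironment P w δ p) :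
    iIndepFun (fun i ω => logOdds (p (i + 1) ω)) P :=
  hp.indep.comp (fun _ => logOdds) fun _ => measurable_logOdds

lemma IsBetaEnvironment.memLp_logOdds (hp : IsBetaEnvironment P w δ p) (hδ : 0 < δ)
    (hw : ∀ i, 0 < w i) (i : ℕ) : MemLp (fun ω => logOdds (p (i + 1) ω)) 2 P := by
  have h := _root_.memLp_logOdds (a := w (i + 1) / (2 * δ)) (b := (w i + δ) / (2 * δ))
    (by have := hw (i + 1); positivity) (by have := hw i; positivity)
  rw [← (hp.law i).map_eq] at h
  exact h.comp_of_map (hp.law i).aemeasurable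

lemma IsBetaEnvironment.integral_logOdds (hp : IsBetaEnvironment P w δ p) (hδ : 0 < δ)
    (hw : ∀ i, 0 < w i) (i : ℕ) : ∫ ω, logOdds (p (i + 1) ω) ∂P =
      realDigamma ((w i + δ) / (2 * δ)) - realDigamma (w (i + 1) / (2 * δ)) := by
  rw [← _root_.integral_logOdds (by have := hw (i + 1); positivity)
    (by have := hw i; positivity)]
  exact (hp.law i).integral_comp measurable_logOdds.aestronglyMeasurable

lemma IsBetaEnvironment.variance_logOdds (hp : IsBetaEnvironment P w δ p) (i : ℕ) :
    Var[fun ω => logOdds (p (i + 1) ω); P] =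
      Var[logOdds; betaMeasure (w (i + 1) / (2 * δ)) ((w i + δ) / (2 * δ))] := by
  rw [← (hp.law i).map_eq, variance_map measurable_logOdds.aemeasurable (hp.law i).aemeasurable]
  rfl

end Environment

/-- `log (1 + δ / w i)` supplies the limit δ; the corrections `-1 / (2 * x)` at the two arguments
cancel to leading order. The difference of `log w` is split off because it telescopes when summed.
-/
lemma tendsto_mul_digamma_sub_of_tendsto_atTop {w : ℕ → ℝ} {δ : ℝ} (hδ : 0 < δ)
    (hw : ∀ i, 0 < w i) (hwt : Tendsto w atTop atTop)
    (hr : Tendsto (fun i => w (i + 1) / w i) atTop (𝓝 1)) :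
    Tendsto (fun i => w (i + 1) * (realDigamma ((w i + δ) / (2 * δ)) -
      realDigamma (w (i + 1) / (2 * δ)) - (Real.log (w i) - Real.log (w (i + 1))))) atTop
      (𝓝 δ) := by
  have hwt1 : Tendsto (fun i => w (i + 1)) atTop atTop := hwt.comp (tendsto_add_atTop_nat 1)
  have hwd : Tendsto (fun i => w i + δ) atTop atTop := tendsto_atTop_add_const_right _ _ hwt
  have r' : Tendsto (fun i => w (i + 1) / (w i + δ)) atTop (𝓝 1) := by
    have h1 : Tendsto (fun i => 1 + δ / w i) atTop (𝓝 1) := by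
      simpa using (hwt.const_div_atTop δ).const_add 1
    have h2 := hr.div h1 one_ne_zero
    rw [div_one] at h2
    refine h2.congr fun i => ?_
    have := hw i
    simp only [Pi.div_apply]
    field_simp
  have main : Tendsto (fun i => w (i + 1) / w i * (w i * Real.log (1 + δ / w i))) atTop
      (𝓝 δ) := by
    simpa using hr.mul ((Real.tendsto_mul_log_one_add_div_atTop δ).comp hwt)
  have mid : Tendsto (fun i => δ * (1 - w (i + 1) / (w i + δ))) atTop (𝓝 0) := by
    simpa using (r'.const_sub 1).const_mul δ
  have err1 : Tendsto (fun i => δ ^ 2 / 2 / w (i + 1)) atTop (𝓝 0) := hwt1.const_div_atTop _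
  have err2 : Tendsto (fun i => w (i + 1) / (w i + δ) * (δ ^ 2 / 2 / (w i + δ))) atTop (𝓝 0) := by
    simpa using r'.mul (hwd.const_div_atTop (δ ^ 2 / 2))
  have lo := (main.add mid).sub err2
  have hi := (main.add mid).add err1
  rw [add_zero, sub_zero] at lo
  rw [add_zero, add_zero] at hi
  have hlog : ∀ i, Real.log ((w i + δ) / (2 * δ)) - Real.log (w (i + 1) / (2 * δ)) =
      Real.log (1 + δ / w i) + (Real.log (w i) - Real.log (w (i + 1))) := by
    intro i
    have h0 := hw i
    have h1 := hw (i + 1)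
    have e : 1 + δ / w i = (w i + δ) / w i := by field_simp
    rw [e, Real.log_div (by positivity) (by positivity), Real.log_div (by positivity)
      (by positivity), Real.log_div (by positivity) (by positivity)]
    ring
  refine tendsto_of_tendsto_of_tendsto_of_le_of_le lo hi (fun i => ?_) (fun i => ?_)
  · have h0 := hw i
    have h1 := hw (i + 1)
    have l1 := le_realDigamma (x := (w i + δ) / (2 * δ)) (by positivity)
    have l2 := realDigamma_le (x := w (i + 1) / (2 * δ)) (by positivity)
    have l3 := mul_le_mul_of_nonneg_left (add_le_add l1 (neg_le_neg l2)) h1.le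
    have e : w (i + 1) * (Real.log ((w i + δ) / (2 * δ)) - 1 / (2 * ((w i + δ) / (2 * δ))) -
        1 / (8 * ((w i + δ) / (2 * δ)) ^ 2) + -(Real.log (w (i + 1) / (2 * δ)) -
        1 / (2 * (w (i + 1) / (2 * δ))))) = w (i + 1) * (Real.log ((w i + δ) / (2 * δ)) -
        Real.log (w (i + 1) / (2 * δ))) + δ * (1 - w (i + 1) / (w i + δ)) -
        w (i + 1) / (w i + δ) * (δ ^ 2 / 2 / (w i + δ)) := by
      field_simp
      ring
    rw [e, hlog] at l3
    have e2 : w (i + 1) / w i * (w i * Real.log (1 + δ / w i)) =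
        w (i + 1) * Real.log (1 + δ / w i) := by field_simp
    simp only [e2]
    linarith
  · have h0 := hw i
    have h1 := hw (i + 1)
    have l1 := realDigamma_le (x := (w i + δ) / (2 * δ)) (by positivity)
    have l2 := le_realDigamma (x := w (i + 1) / (2 * δ)) (by positivity)
    have l3 := mul_le_mul_of_nonneg_left (add_le_add l1 (neg_le_neg l2)) h1.le
    have e : w (i + 1) * (Real.log ((w i + δ) / (2 * δ)) - 1 / (2 * ((w i + δ) / (2 * δ))) +
        -(Real.log (w (i + 1) / (2 * δ)) - 1 / (2 * (w (i + 1) / (2 * δ))) -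
        1 / (8 * (w (i + 1) / (2 * δ)) ^ 2))) = w (i + 1) * (Real.log ((w i + δ) / (2 * δ)) -
        Real.log (w (i + 1) / (2 * δ))) + δ * (1 - w (i + 1) / (w i + δ)) +
        δ ^ 2 / 2 / w (i + 1) := by
      field_simp
      ring
    rw [e, hlog] at l3
    have e2 : w (i + 1) / w i * (w i * Real.log (1 + δ / w i)) =
        w (i + 1) * Real.log (1 + δ / w i) := by field_simp
    simp only [e2]
    linarith

/-- The recurrence isolates the pole `-2 * δ / w (i + 1)`; the remaining digamma values stay bounded
and are killed by the weight. -/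
lemma tendsto_mul_digamma_sub_of_tendsto_zero {w : ℕ → ℝ} {δ : ℝ} (hδ : 0 < δ)
    (hw : ∀ i, 0 < w i) (hwt : Tendsto w atTop (𝓝 0)) :
    Tendsto (fun i => w (i + 1) * (realDigamma ((w i + δ) / (2 * δ)) -
      realDigamma (w (i + 1) / (2 * δ)))) atTop (𝓝 (2 * δ)) := by
  have hwt1 : Tendsto (fun i => w (i + 1)) atTop (𝓝 0) := hwt.comp (tendsto_add_atTop_nat 1)
  have hlog : ∀ {x : ℕ → ℝ} {c : ℝ}, 0 < c → Tendsto x atTop (𝓝 c) →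
      Tendsto (fun i => w (i + 1) * realDigamma (x i)) atTop (𝓝 0) := by
    intro x c hc hx
    have h1 : Tendsto (fun i => w (i + 1) * Real.log (x i)) atTop (𝓝 0) := by
      simpa using hwt1.mul (hx.log hc.ne')
    have h2 : Tendsto (fun i => w (i + 1) * (Real.log (x i) - 1 / x i)) atTop (𝓝 0) := by
      simpa using hwt1.mul ((hx.log hc.ne').sub (hx.inv₀ hc.ne'))
    refine tendsto_of_tendsto_of_tendsto_of_le_of_le' h2 h1 ?_ ?_
    · filter_upwards [hx.eventually_const_lt hc] with i hi
      exact mul_le_mul_of_nonneg_left (log_sub_le_realDigamma hi) (hw _).le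
    · filter_upwards [hx.eventually_const_lt hc] with i hi
      exact mul_le_mul_of_nonneg_left (realDigamma_le_log hi) (hw _).le
  have hb : Tendsto (fun i => (w i + δ) / (2 * δ)) atTop (𝓝 ((0 + δ) / (2 * δ))) :=
    (hwt.add_const δ).div_const _
  have ha : Tendsto (fun i => w (i + 1) / (2 * δ) + 1) atTop (𝓝 1) := by
    simpa using (hwt1.div_const (2 * δ)).add_const 1
  have h := ((hlog (by positivity) hb).sub (hlog one_pos ha)).add_const (2 * δ)
  rw [sub_zero, zero_add] at h
  refine h.congr fun i => ?_
  have h1 := hw (i + 1)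
  rw [realDigamma_add_one (by positivity)]
  field_simp
  ring

/-- Each term is at most `1 / B i - 1 / B (i + 1)`, which telescopes. -/
lemma summable_sub_div_sq {B : ℕ → ℝ} (hBt : Tendsto B atTop atTop)
    (hD : ∀ᶠ i in atTop, 0 < B (i + 1) - B i) :
    Summable fun i => (B (i + 1) - B i) / B (i + 1) ^ 2 := by
  obtain ⟨N, hN⟩ := eventually_atTop.1 (hD.and (hBt.eventually_gt_atTop 0))
  rw [← summable_nat_add_iff N]
  have hpos : ∀ i, 0 < B (i + N) := fun i => (hN _ (Nat.le_add_left _ _)).2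
  have hd : ∀ i, 0 < B (i + 1 + N) - B (i + N) := fun i => by
    have := (hN (i + N) (Nat.le_add_left _ _)).1
    rwa [show i + N + 1 = i + 1 + N by ring] at this
  refine summable_of_sum_range_le (c := 1 / B (0 + N)) (fun i => ?_) fun n => ?_
  · rw [show i + N + 1 = i + 1 + N by ring]
    exact div_nonneg (hd i).le (sq_nonneg _)
  · calc ∑ i ∈ Finset.range n, (B (i + N + 1) - B (i + N)) / B (i + N + 1) ^ 2
        ≤ ∑ i ∈ Finset.range n, (1 / B (i + N) - 1 / B (i + 1 + N)) := by
          refine Finset.sum_le_sum fun i _ => ?_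
          rw [show i + N + 1 = i + 1 + N by ring]
          have h0 := hpos i
          have h1 := hpos (i + 1)
          have h2 := hd i
          rw [div_sub_div _ _ h0.ne' h1.ne', one_mul, mul_one]
          refine div_le_div_of_nonneg_left h2.le (by positivity) ?_
          nlinarith
      _ = 1 / B (0 + N) - 1 / B (n + N) := Finset.sum_range_sub' (fun i => 1 / B (i + N)) n
      _ ≤ 1 / B (0 + N) := by
          have := hpos n
          have : 0 < 1 / B (n + N) := by positivity
          linarith

/-! ### Limit theorems for general weights. -/

section Asymptotics

variable {Ω : Type*} [MeasurableSpace Ω] {P : Measure Ω} [IsProbabilityMeasure P]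
  {w B : ℕ → ℝ} {δ : ℝ} {p : ℕ → Ω → ℝ}

/-- Asymptotics of the logarithmic resistance for weights tending to infinity. -/
theorem IsBetaEnvironment.ae_tendsto_of_tendsto_atTop {l κ : ℝ} (hp : IsBetaEnvironment P w δ p)
    (hδ : 0 < δ) (hw : ∀ i, 0 < w i) (hwt : Tendsto w atTop atTop)
    (hr : Tendsto (fun i => w (i + 1) / w i) atTop (𝓝 1)) (hBt : Tendsto B atTop atTop)
    (hD : ∀ᶠ i in atTop, 0 < B (i + 1) - B i)
    (hl : Tendsto (fun i => 1 / (w (i + 1) * (B (i + 1) - B i))) atTop (𝓝 l))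
    (hκ : Tendsto (fun n => Real.log (w n) / B n) atTop (𝓝 κ)) :
    ∀ᵐ ω ∂P, Tendsto (fun n => logResistance p n ω / B n) atTop (𝓝 (δ * l - κ)) := by
  simp_rw [logResistance_eq_sum_range]
  have hwt1 : Tendsto (fun i => w (i + 1)) atTop atTop := hwt.comp (tendsto_add_atTop_nat 1)
  refine ae_tendsto_sum_div (hp.memLp_logOdds hδ hw) hp.iIndepFun_logOdds hBt
    (hD.mono fun i hi => (sub_pos.1 hi).le) ?_ ?_
  -- The variance is `O(1 / w (i + 1))`, hence `O(B (i + 1) - B i)` because `l` is finite. Weights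
  -- above `4 * δ` keep both beta parameters at least 2.
  · have hsum := (summable_sub_div_sq hBt hD).mul_left (24 * δ * (l + 1))
    refine Summable.of_norm_bounded_eventually_nat hsum ?_
    filter_upwards [hD, hl.eventually_le_const (lt_add_one l),
      hr.eventually_lt_const one_lt_two, hwt.eventually_ge_atTop (4 * δ),
      hwt1.eventually_ge_atTop (4 * δ)] with i hDi hli hri hwi hwi1
    have h0 := hw i
    have h1 := hw (i + 1)
    rw [Real.norm_of_nonneg (div_nonneg (variance_nonneg _ _) (sq_nonneg _)), ← mul_div_assoc]
    gcongr
    have ha : 2 ≤ w (i + 1) / (2 * δ) := by rw [le_div_iff₀ (by positivity)]; linarith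
    have hb : 2 ≤ (w i + δ) / (2 * δ) := by rw [le_div_iff₀ (by positivity)]; linarith
    rw [hp.variance_logOdds]
    refine (variance_logOdds_le_of_one_lt (by linarith) (by linarith)).trans ?_
    have b1 : 1 / (w (i + 1) / (2 * δ) - 1) ≤ 4 * δ / w (i + 1) := by
      rw [div_le_div_iff₀ (by linarith) h1]
      have : 4 * δ * (w (i + 1) / (2 * δ) - 1) = 2 * w (i + 1) - 4 * δ := by field_simp; ring
      rw [this]; linarith
    have b2 : 1 / ((w i + δ) / (2 * δ) - 1) ≤ 8 * δ / w (i + 1) := by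
      rw [div_le_div_iff₀ (by linarith) h1]
      have : 8 * δ * ((w i + δ) / (2 * δ) - 1) = 4 * w i - 4 * δ := by field_simp; ring
      rw [this]
      have : w (i + 1) < 2 * w i := by rwa [div_lt_iff₀ h0] at hri
      linarith
    have b3 : 1 / w (i + 1) ≤ (l + 1) * (B (i + 1) - B i) := by
      rw [div_le_iff₀ (by positivity)] at hli
      rw [div_le_iff₀ h1]
      linarith
    calc 2 * (1 / (w (i + 1) / (2 * δ) - 1) + 1 / ((w i + δ) / (2 * δ) - 1))
        ≤ 2 * (4 * δ / w (i + 1) + 8 * δ / w (i + 1)) := by gcongr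
      _ = 24 * δ * (1 / w (i + 1)) := by ring
      _ ≤ 24 * δ * ((l + 1) * (B (i + 1) - B i)) := by gcongr
      _ = _ := by ring
  · simp_rw [hp.integral_logOdds hδ hw]
    have hm := (tendsto_mul_digamma_sub_of_tendsto_atTop hδ hw hwt hr).mul hl
    have hm' := sum_range_div_tendsto hBt hD (hm.congr' (f₂ := fun i =>
        (realDigamma ((w i + δ) / (2 * δ)) - realDigamma (w (i + 1) / (2 * δ)) -
          (Real.log (w i) - Real.log (w (i + 1)))) / (B (i + 1) - B i)) (by
      filter_upwards [hD] with i hi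
      have h1 := hw (i + 1)
      field_simp))
    have h2 := (hm'.sub hκ).add (hBt.const_div_atTop (Real.log (w 0)))
    rw [add_zero] at h2
    refine h2.congr fun n => ?_
    rw [Finset.sum_sub_distrib, Finset.sum_range_sub' (fun i => Real.log (w i)) n]
    ring

/-- Asymptotics of the logarithmic resistance for weights tending to zero. -/
theorem IsBetaEnvironment.ae_tendsto_of_tendsto_zero {c : ℝ} (hp : IsBetaEnvironment P w δ p)
    (hδ : 0 < δ) (hw : ∀ i, 0 < w i) (hwt : Tendsto w atTop (𝓝 0)) (hBt : Tendsto B atTop atTop)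
    (hwB : ∀ᶠ i in atTop, w i * B i = i) (hc : 0 < c)
    (hD : Tendsto (fun i => w (i + 1) * (B (i + 1) - B i)) atTop (𝓝 c)) :
    ∀ᵐ ω ∂P, Tendsto (fun n => logResistance p n ω / B n) atTop (𝓝 (2 * δ / c)) := by
  simp_rw [logResistance_eq_sum_range]
  have hwt1 : Tendsto (fun i => w (i + 1)) atTop (𝓝 0) := hwt.comp (tendsto_add_atTop_nat 1)
  have hD' : ∀ᶠ i in atTop, 0 < B (i + 1) - B i := by
    filter_upwards [hD.eventually_const_lt hc] with i hi
    exact (pos_iff_pos_of_mul_pos hi).1 (hw _)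
  refine ae_tendsto_sum_div (hp.memLp_logOdds hδ hw) hp.iIndepFun_logOdds hBt
    (hD'.mono fun i hi => (sub_pos.1 hi).le) ?_ ?_
  -- With `a = w / (2 * δ)`, `a ^ 2 * Var ≤ 8` and `w * B = i + 1`, the quotient is at most `32 * δ
  -- ^ 2 / (i + 1) ^ 2`.
  · have hsum : Summable fun i : ℕ => 32 * δ ^ 2 * (1 / ((i + 1 : ℕ) : ℝ) ^ 2) :=
      ((summable_nat_add_iff 1).2 (Real.summable_one_div_nat_pow.2 one_lt_two)).mul_left _
    refine Summable.of_norm_bounded_eventually_nat hsum ?_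
    have hb : Tendsto (fun i => (w i + δ) / (2 * δ)) atTop (𝓝 ((0 + δ) / (2 * δ))) :=
      (hwt.add_const δ).div_const _
    have ha : Tendsto (fun i => w (i + 1) / (2 * δ)) atTop (𝓝 0) := by
      simpa using hwt1.div_const (2 * δ)
    filter_upwards [eventually_sq_mul_variance_logOdds_le (by positivity)
      (fun i => by have := hw (i + 1); positivity) ha hb,
      (tendsto_add_atTop_nat 1).eventually hwB,
      (tendsto_add_atTop_nat 1).eventually (hBt.eventually_gt_atTop 0)] with i hv hB hB0
    have h1 := hw (i + 1)
    rw [Real.norm_of_nonneg (div_nonneg (variance_nonneg _ _) (sq_nonneg _)),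
      hp.variance_logOdds, ← hB, div_le_iff₀ (by positivity)]
    have : 32 * δ ^ 2 * (1 / (w (i + 1) * B (i + 1)) ^ 2) * B (i + 1) ^ 2 =
        8 / (w (i + 1) / (2 * δ)) ^ 2 := by field_simp; norm_num
    rw [this, le_div_iff₀ (by positivity)]
    linarith
  · simp_rw [hp.integral_logOdds hδ hw]
    have hm := (tendsto_mul_digamma_sub_of_tendsto_zero hδ hw hwt).div hD hc.ne'
    refine sum_range_div_tendsto hBt hD' (hm.congr' ?_)
    filter_upwards [hD'] with i hi
    have h1 := hw (i + 1)
    simp only [Pi.div_apply]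
    rw [mul_div_mul_left _ _ h1.ne']

end Asymptotics

/-! ### Growth and increments of the initial weights. -/

lemma tendsto_log_natCast_atTop : Tendsto (fun n : ℕ => Real.log n) atTop atTop :=
  Real.tendsto_log_atTop.comp tendsto_natCast_atTop_atTop

lemma eventually_log_natCast_pos : ∀ᶠ n : ℕ in atTop, 0 < Real.log n :=
  tendsto_log_natCast_atTop.eventually_gt_atTop 0

lemma tendsto_rpow_mul_log_rpow_atTop {s : ℝ} (hs : 0 < s) (r : ℝ) :
    Tendsto (fun n : ℕ => (n : ℝ) ^ s * Real.log n ^ r) atTop atTop := by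
  have h := (isLittleO_log_rpow_rpow_atTop (-r) hs).tendsto_div_nhds_zero.comp
    (tendsto_natCast_atTop_atTop (R := ℝ))
  have h2 : Tendsto (fun n : ℕ => Real.log n ^ (-r) / (n : ℝ) ^ s) atTop (𝓝[>] 0) := by
    refine tendsto_nhdsWithin_iff.2 ⟨h, ?_⟩
    filter_upwards [eventually_log_natCast_pos, eventually_gt_atTop 0] with n hn hn0
    have : (0 : ℝ) < n := Nat.cast_pos.2 hn0
    exact Set.mem_Ioi.2 (by positivity)
  refine h2.inv_tendsto_nhdsGT_zero.congr' ?_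
  filter_upwards [eventually_log_natCast_pos] with n hn
  simp only [Pi.inv_apply]
  rw [inv_div, Real.rpow_neg hn.le, div_inv_eq_mul]

lemma tendsto_rpow_mul_log_rpow_zero {s : ℝ} (hs : s < 0) (r : ℝ) :
    Tendsto (fun n : ℕ => (n : ℝ) ^ s * Real.log n ^ r) atTop (𝓝 0) := by
  refine (tendsto_rpow_mul_log_rpow_atTop (neg_pos.2 hs) (-r)).inv_tendsto_atTop.congr' ?_
  filter_upwards [eventually_log_natCast_pos] with n hn
  simp only [Pi.inv_apply]
  rw [Real.rpow_neg hn.le, Real.rpow_neg n.cast_nonneg, ← mul_inv, inv_inv]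

/-- Differentiability of `x ^ r` at 1; `k` records the rate at which `u` tends to 1. -/
lemma tendsto_mul_rpow_sub_one {k u : ℕ → ℝ} {c : ℝ} (r : ℝ) (hu : Tendsto u atTop (𝓝 1))
    (h : Tendsto (fun n => k n * (u n - 1)) atTop (𝓝 c)) :
    Tendsto (fun n => k n * (u n ^ r - 1)) atTop (𝓝 (r * c)) := by
  have hd : HasDerivAt (fun x : ℝ => x ^ r) r 1 := by
    simpa using Real.hasDerivAt_rpow_const (x := 1) (p := r) (Or.inl one_ne_zero)
  have ho := (hasDerivAt_iff_isLittleO.1 hd).comp_tendsto hu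
  have h1 := (Asymptotics.isBigO_refl k atTop).mul_isLittleO ho
  have h2 := (h1.trans_isBigO (h.isBigO_one ℝ)).tendsto_div_nhds_zero
  have h3 := h2.add (h.const_mul r)
  rw [zero_add] at h3
  refine h3.congr fun n => ?_
  simp
  ring

lemma tendsto_mul_mul_sub_one {k u v : ℕ → ℝ} {c d : ℝ} (hv : Tendsto v atTop (𝓝 1))
    (hc : Tendsto (fun n => k n * (u n - 1)) atTop (𝓝 c))
    (hd : Tendsto (fun n => k n * (v n - 1)) atTop (𝓝 d)) :
    Tendsto (fun n => k n * (u n * v n - 1)) atTop (𝓝 (c + d)) := by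
  have h := (hc.mul hv).add hd
  rw [mul_one] at h
  exact h.congr fun n => by ring

lemma tendsto_one_of_mul_sub_one {k u : ℕ → ℝ} {c : ℝ} (hk : Tendsto k atTop atTop)
    (h : Tendsto (fun n => k n * (u n - 1)) atTop (𝓝 c)) : Tendsto u atTop (𝓝 1) := by
  have h1 := (h.mul hk.inv_tendsto_atTop).add_const 1
  rw [mul_zero, zero_add] at h1
  refine h1.congr' ?_
  filter_upwards [hk.eventually_gt_atTop 0] with n hn
  simp only [Pi.inv_apply]
  field_simp
  ring

lemma tendsto_mul_log_add_one_sub_log :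
    Tendsto (fun n : ℕ => (n : ℝ) * (Real.log (n + 1 : ℕ) - Real.log n)) atTop (𝓝 1) := by
  refine ((Real.tendsto_mul_log_one_add_div_atTop 1).comp
    tendsto_natCast_atTop_atTop).congr' ?_
  filter_upwards [eventually_gt_atTop 0] with n hn
  have : (0 : ℝ) < n := Nat.cast_pos.2 hn
  simp only [Function.comp_apply]
  rw [← Real.log_div (by positivity) this.ne']
  congr 2
  push_cast
  field_simp

lemma tendsto_mul_log_mul_log_ratio_sub_one :
    Tendsto (fun n : ℕ => (n : ℝ) * Real.log n * (Real.log (n + 1 : ℕ) / Real.log n - 1)) atTop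
      (𝓝 1) := by
  refine tendsto_mul_log_add_one_sub_log.congr' ?_
  filter_upwards [eventually_log_natCast_pos] with n hn
  field_simp

lemma tendsto_natCast_mul_log_atTop :
    Tendsto (fun n : ℕ => (n : ℝ) * Real.log n) atTop atTop :=
  tendsto_natCast_atTop_atTop.atTop_mul_atTop₀ tendsto_log_natCast_atTop

lemma tendsto_log_ratio :
    Tendsto (fun n : ℕ => Real.log (n + 1 : ℕ) / Real.log n) atTop (𝓝 1) :=
  tendsto_one_of_mul_sub_one tendsto_natCast_mul_log_atTop tendsto_mul_log_mul_log_ratio_sub_one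

lemma tendsto_mul_log_ratio_sub_one :
    Tendsto (fun n : ℕ => (n : ℝ) * (Real.log (n + 1 : ℕ) / Real.log n - 1)) atTop (𝓝 0) := by
  have h := tendsto_mul_log_mul_log_ratio_sub_one.mul tendsto_log_natCast_atTop.inv_tendsto_atTop
  rw [mul_zero] at h
  refine h.congr' ?_
  filter_upwards [eventually_log_natCast_pos] with n hn
  simp only [Pi.inv_apply]
  field_simp

lemma initialWeight_of_two_le {α β : ℝ} {n : ℕ} (hn : 2 ≤ n) :
    initialWeight α β n = (n : ℝ) ^ α * Real.log n ^ β := by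
  rw [initialWeight, if_neg (by omega)]

lemma log_natCast_pos {n : ℕ} (hn : 2 ≤ n) : 0 < Real.log n :=
  Real.log_pos (by exact_mod_cast hn)

lemma initialWeight_pos (α β : ℝ) (n : ℕ) : 0 < initialWeight α β n := by
  rcases le_or_gt n 1 with h | h
  · simp [initialWeight, h]
  · rw [initialWeight_of_two_le h]
    have := log_natCast_pos h
    have : (0 : ℝ) < n := Nat.cast_pos.2 (by omega)
    positivity

lemma eventuallyEq_initialWeight (α β : ℝ) :
    (fun n : ℕ => (n : ℝ) ^ α * Real.log n ^ β) =ᶠ[atTop] initialWeight α β := by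
  filter_upwards [eventually_ge_atTop 2] with n hn using (initialWeight_of_two_le hn).symm

lemma tendsto_mul_initialWeight_ratio_sub_one (α β : ℝ) :
    Tendsto (fun n : ℕ => (n : ℝ) * (initialWeight α β (n + 1) / initialWeight α β n - 1)) atTop
      (𝓝 α) := by
  have hu : Tendsto (fun n : ℕ => (n : ℝ) * (((n + 1 : ℕ) : ℝ) / n - 1)) atTop (𝓝 1) := by
    refine tendsto_const_nhds.congr' ?_
    filter_upwards [eventually_gt_atTop 0] with n hn
    have : (0 : ℝ) < n := Nat.cast_pos.2 hn
    push_cast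
    field_simp
    ring
  have h1 := tendsto_mul_rpow_sub_one α
    (tendsto_one_of_mul_sub_one tendsto_natCast_atTop_atTop hu) hu
  have h2 := tendsto_mul_rpow_sub_one β tendsto_log_ratio tendsto_mul_log_ratio_sub_one
  have h3 := tendsto_mul_mul_sub_one
    (tendsto_one_of_mul_sub_one tendsto_natCast_atTop_atTop h2) h1 h2
  rw [mul_one, mul_zero, add_zero] at h3
  refine h3.congr' ?_
  filter_upwards [eventually_ge_atTop 2] with n hn
  rw [initialWeight_of_two_le hn, initialWeight_of_two_le (by omega : 2 ≤ n + 1),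
    Real.div_rpow (Nat.cast_nonneg _) (Nat.cast_nonneg _),
    Real.div_rpow (log_natCast_pos (by omega)).le (log_natCast_pos hn).le, div_mul_div_comm]

lemma tendsto_initialWeight_ratio (α β : ℝ) :
    Tendsto (fun n => initialWeight α β (n + 1) / initialWeight α β n) atTop (𝓝 1) :=
  tendsto_one_of_mul_sub_one tendsto_natCast_atTop_atTop
    (tendsto_mul_initialWeight_ratio_sub_one α β)

lemma initialWeight_mul_eq {α β : ℝ} {n : ℕ} (hn : 2 ≤ n) :
    initialWeight α β n * ((n : ℝ) ^ (1 - α) * Real.log n ^ (-β)) = n := by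
  have h0 : (0 : ℝ) < n := Nat.cast_pos.2 (by omega)
  have h1 := log_natCast_pos hn
  rw [initialWeight_of_two_le hn, Real.rpow_sub h0, Real.rpow_neg h1.le, Real.rpow_one]
  field_simp

/-- The normalization is exactly `n / w n` for `n ≥ 2`, so the product equals `1 - n * (w (n + 1) /
w n - 1)`. -/
lemma tendsto_initialWeight_mul_sub (α β : ℝ) :
    Tendsto (fun n : ℕ => initialWeight α β (n + 1) *
      (((n + 1 : ℕ) : ℝ) ^ (1 - α) * Real.log (n + 1 : ℕ) ^ (-β) -
        (n : ℝ) ^ (1 - α) * Real.log n ^ (-β))) atTop (𝓝 (1 - α)) := by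
  refine ((tendsto_mul_initialWeight_ratio_sub_one α β).const_sub 1).congr' ?_
  filter_upwards [eventually_ge_atTop 2] with n hn
  have h0 := initialWeight_pos α β n
  have e : (n : ℝ) ^ (1 - α) * Real.log n ^ (-β) = n / initialWeight α β n := by
    rw [eq_div_iff h0.ne', mul_comm, initialWeight_mul_eq hn]
  rw [mul_sub (initialWeight α β (n + 1)), initialWeight_mul_eq (by omega : 2 ≤ n + 1), e]
  push_cast
  field_simp
  ring

lemma tendsto_log_log_div_log :
    Tendsto (fun n : ℕ => Real.log (Real.log n) / Real.log n) atTop (𝓝 0) :=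
  (Real.isLittleO_log_id_atTop.tendsto_div_nhds_zero).comp tendsto_log_natCast_atTop

lemma tendsto_log_initialWeight_div {α β k : ℝ} {B : ℕ → ℝ}
    (hk : Tendsto (fun n : ℕ => Real.log n / B n) atTop (𝓝 k)) :
    Tendsto (fun n => Real.log (initialWeight α β n) / B n) atTop (𝓝 (α * k)) := by
  have h := (hk.const_mul α).add ((tendsto_log_log_div_log.mul hk).const_mul β)
  rw [zero_mul, mul_zero, add_zero] at h
  refine h.congr' ?_
  filter_upwards [eventually_ge_atTop 2] with n hn
  have h0 : (0 : ℝ) < n := Nat.cast_pos.2 (by omega)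
  have h1 := log_natCast_pos hn
  rw [initialWeight_of_two_le hn, Real.log_mul (by positivity) (by positivity),
    Real.log_rpow h0, Real.log_rpow h1]
  field_simp

lemma eventually_sub_pos_of_tendsto {w B : ℕ → ℝ} {c : ℝ} (hw : ∀ i, 0 < w i) (hc : 0 < c)
    (h : Tendsto (fun i => w (i + 1) * (B (i + 1) - B i)) atTop (𝓝 c)) :
    ∀ᶠ i in atTop, 0 < B (i + 1) - B i := by
  filter_upwards [h.eventually_const_lt hc] with i hi
  exact (pos_iff_pos_of_mul_pos hi).1 (hw _)

/-! ### The regimes of α and β. -/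

section Cases

variable {Ω : Type*} [MeasurableSpace Ω] {P : Measure Ω} [IsProbabilityMeasure P]
  {α β δ : ℝ} {p : ℕ → Ω → ℝ}

theorem ae_tendsto_logResistance_of_initialWeight_tendsto_zero
    (hp : IsBetaEnvironment P (initialWeight α β) δ p) (hδ : 0 < δ) (hα : α < 1)
    (hw : Tendsto (initialWeight α β) atTop (𝓝 0)) :
    ∀ᵐ ω ∂P, Tendsto (fun x : ℕ => logResistance p x ω / ((x : ℝ) ^ (1 - α) * Real.log x ^ (-β)))
      atTop (𝓝 (2 * δ / (1 - α))) :=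
  hp.ae_tendsto_of_tendsto_zero (B := fun x : ℕ => (x : ℝ) ^ (1 - α) * Real.log x ^ (-β)) hδ
    (initialWeight_pos α β) hw
    (tendsto_rpow_mul_log_rpow_atTop (sub_pos.2 hα) _)
    ((eventually_ge_atTop 2).mono fun _ hn => initialWeight_mul_eq hn) (sub_pos.2 hα)
    (tendsto_initialWeight_mul_sub α β)

theorem ae_tendsto_logResistance_of_initialWeight_tendsto_atTop
    (hp : IsBetaEnvironment P (initialWeight α β) δ p) (hδ : 0 < δ) (hα : α < 1)
    (hw : Tendsto (initialWeight α β) atTop atTop) :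
    ∀ᵐ ω ∂P, Tendsto (fun x : ℕ => logResistance p x ω / ((x : ℝ) ^ (1 - α) * Real.log x ^ (-β)))
      atTop (𝓝 (δ / (1 - α))) := by
  have hα' := sub_pos.2 hα
  have hD := tendsto_initialWeight_mul_sub α β
  have hk : Tendsto (fun n : ℕ => Real.log n / ((n : ℝ) ^ (1 - α) * Real.log n ^ (-β))) atTop
      (𝓝 0) := by
    refine (tendsto_rpow_mul_log_rpow_atTop hα' (-β - 1)).inv_tendsto_atTop.congr' ?_
    filter_upwards [eventually_ge_atTop 2] with n hn
    have h0 : (0 : ℝ) < n := Nat.cast_pos.2 (by omega)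
    have h1 := log_natCast_pos hn
    simp only [Pi.inv_apply]
    rw [Real.rpow_sub_one h1.ne']
    field_simp
  have h := hp.ae_tendsto_of_tendsto_atTop
    (B := fun x : ℕ => (x : ℝ) ^ (1 - α) * Real.log x ^ (-β)) (l := 1 / (1 - α)) hδ
    (initialWeight_pos α β) hw (tendsto_initialWeight_ratio α β)
    (tendsto_rpow_mul_log_rpow_atTop hα' _)
    (eventually_sub_pos_of_tendsto
      (B := fun x : ℕ => (x : ℝ) ^ (1 - α) * Real.log x ^ (-β)) (initialWeight_pos α β) hα' hD)
    (tendsto_const_nhds.div hD hα'.ne') (tendsto_log_initialWeight_div hk)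
  rwa [mul_zero, sub_zero, mul_one_div] at h

/-- Here `∑ 1 / w i` is of order `(ln n) ^ (1 - β)`, which dominates `log w n ~ ln n` because β < 0.
-/
theorem ae_tendsto_logResistance_div_log_rpow (hp : IsBetaEnvironment P (initialWeight 1 β) δ p)
    (hδ : 0 < δ) (hβ : β < 0) :
    ∀ᵐ ω ∂P, Tendsto (fun x : ℕ => logResistance p x ω / Real.log x ^ (1 - β)) atTop
      (𝓝 (δ / (1 - β))) := by
  have hβ' : 0 < 1 - β := by linarith
  have hB : Tendsto (fun x : ℕ => Real.log x ^ (1 - β)) atTop atTop :=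
    (tendsto_rpow_atTop hβ').comp tendsto_log_natCast_atTop
  have hD : Tendsto (fun n : ℕ => initialWeight 1 β (n + 1) *
      (Real.log (n + 1 : ℕ) ^ (1 - β) - Real.log n ^ (1 - β))) atTop (𝓝 (1 - β)) := by
    have h := (tendsto_initialWeight_ratio 1 β).mul (tendsto_mul_rpow_sub_one (1 - β)
      tendsto_log_ratio tendsto_mul_log_mul_log_ratio_sub_one)
    rw [one_mul, mul_one] at h
    refine h.congr' ?_
    filter_upwards [eventually_ge_atTop 2] with n hn
    have h0 : (0 : ℝ) < n := Nat.cast_pos.2 (by omega)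
    have h1 := log_natCast_pos hn
    have h2 := log_natCast_pos (by omega : 2 ≤ n + 1)
    have hw0 := initialWeight_pos 1 β n
    have e : (n : ℝ) * Real.log n = initialWeight 1 β n * Real.log n ^ (1 - β) := by
      rw [initialWeight_of_two_le hn, Real.rpow_one, mul_assoc, ← Real.rpow_add h1]
      simp
    rw [e, Real.div_rpow h2.le h1.le]
    field_simp
  have hk : Tendsto (fun n : ℕ => Real.log n / Real.log n ^ (1 - β)) atTop (𝓝 0) := by
    refine ((tendsto_rpow_neg_atTop (neg_pos.2 hβ)).comp tendsto_log_natCast_atTop).congr' ?_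
    filter_upwards [eventually_log_natCast_pos] with n hn
    simp only [Function.comp_apply, neg_neg]
    rw [Real.rpow_sub hn, Real.rpow_one]
    field_simp
  have h := hp.ae_tendsto_of_tendsto_atTop (B := fun x : ℕ => Real.log x ^ (1 - β))
    (l := 1 / (1 - β)) hδ (initialWeight_pos 1 β)
    ((tendsto_rpow_mul_log_rpow_atTop one_pos β).congr' (eventuallyEq_initialWeight 1 β))
    (tendsto_initialWeight_ratio 1 β) hB
    (eventually_sub_pos_of_tendsto (B := fun x : ℕ => Real.log x ^ (1 - β))
      (initialWeight_pos 1 β) hβ' hD)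
    (tendsto_const_nhds.div hD hβ'.ne') (tendsto_log_initialWeight_div hk)
  rwa [mul_zero, sub_zero, mul_one_div] at h

/-- The weight times the increment of `ln` grows like `(ln n) ^ β`, so `l = 0`; the telescoped `log
w n ~ ln n` gives the whole limit. -/
theorem ae_tendsto_logResistance_div_log (hp : IsBetaEnvironment P (initialWeight 1 β) δ p)
    (hδ : 0 < δ) (hβ : 0 < β) :
    ∀ᵐ ω ∂P, Tendsto (fun x : ℕ => logResistance p x ω / Real.log x) atTop (𝓝 (-1)) := by
  have hD : Tendsto (fun n : ℕ => initialWeight 1 β (n + 1) *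
      (Real.log (n + 1 : ℕ) - Real.log n)) atTop atTop := by
    have h := (((tendsto_rpow_atTop hβ).comp tendsto_log_natCast_atTop).atTop_mul_pos one_pos
      tendsto_mul_log_add_one_sub_log).atTop_mul_pos one_pos (tendsto_initialWeight_ratio 1 β)
    refine h.congr' ?_
    filter_upwards [eventually_ge_atTop 2] with n hn
    have h0 : (0 : ℝ) < n := Nat.cast_pos.2 (by omega)
    have h1 := log_natCast_pos hn
    simp only [Function.comp_apply]
    rw [initialWeight_of_two_le hn, Real.rpow_one]
    field_simp
  have hD' : ∀ᶠ n : ℕ in atTop, 0 < Real.log (n + 1 : ℕ) - Real.log n := by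
    filter_upwards [hD.eventually_gt_atTop 0] with n hn
    exact (pos_iff_pos_of_mul_pos hn).1 (initialWeight_pos _ _ _)
  have hk : Tendsto (fun n : ℕ => Real.log n / Real.log n) atTop (𝓝 1) := by
    refine tendsto_const_nhds.congr' ?_
    filter_upwards [eventually_log_natCast_pos] with n hn
    rw [div_self hn.ne']
  have h := hp.ae_tendsto_of_tendsto_atTop (B := fun x : ℕ => Real.log x)
    (l := 0) hδ (initialWeight_pos 1 β)
    ((tendsto_rpow_mul_log_rpow_atTop one_pos β).congr' (eventuallyEq_initialWeight 1 β))
    (tendsto_initialWeight_ratio 1 β) tendsto_log_natCast_atTop hD'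
    (hD.const_div_atTop 1) (tendsto_log_initialWeight_div hk)
  simpa using h

end Cases

lemma tendsto_initialWeight_atTop {α β : ℝ} (h : 0 < α ∨ α = 0 ∧ 0 < β) :
    Tendsto (initialWeight α β) atTop atTop := by
  refine Tendsto.congr' (eventuallyEq_initialWeight α β) ?_
  rcases h with h | ⟨rfl, h⟩
  · exact tendsto_rpow_mul_log_rpow_atTop h β
  · simpa [Function.comp_def] using (tendsto_rpow_atTop h).comp tendsto_log_natCast_atTop

lemma tendsto_initialWeight_zero {α β : ℝ} (h : α < 0 ∨ α = 0 ∧ β < 0) :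
    Tendsto (initialWeight α β) atTop (𝓝 0) := by
  refine Tendsto.congr' (eventuallyEq_initialWeight α β) ?_
  rcases h with h | ⟨rfl, h⟩
  · exact tendsto_rpow_mul_log_rpow_zero h β
  · simpa [Function.comp_def] using
      (tendsto_rpow_neg_atTop (neg_pos.2 h)).comp tendsto_log_natCast_atTop

lemma tendsto_div_rpow_sub_atTop {f : ℕ → ℝ} {a b s L : ℝ} (hL : 0 < L) (hs : 0 < s)
    (h : Tendsto (fun n : ℕ => f n / ((n : ℝ) ^ a * Real.log n ^ b)) atTop (𝓝 L)) :
    Tendsto (fun n : ℕ => f n / (n : ℝ) ^ (a - s)) atTop atTop := by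
  refine (h.pos_mul_atTop hL (tendsto_rpow_mul_log_rpow_atTop hs b)).congr' ?_
  filter_upwards [eventually_ge_atTop 2] with n hn
  have h0 : (0 : ℝ) < n := Nat.cast_pos.2 (by omega)
  have h1 := log_natCast_pos hn
  rw [Real.rpow_sub h0]
  field_simp

lemma tendsto_div_rpow_add_zero {f : ℕ → ℝ} {a b s L : ℝ} (hs : 0 < s)
    (h : Tendsto (fun n : ℕ => f n / ((n : ℝ) ^ a * Real.log n ^ b)) atTop (𝓝 L)) :
    Tendsto (fun n : ℕ => f n / (n : ℝ) ^ (a + s)) atTop (𝓝 0) := by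
  have h2 := h.mul (tendsto_rpow_mul_log_rpow_zero (neg_neg_of_pos hs) b)
  rw [mul_zero] at h2
  refine h2.congr' ?_
  filter_upwards [eventually_ge_atTop 2] with n hn
  have h0 : (0 : ℝ) < n := Nat.cast_pos.2 (by omega)
  have h1 := log_natCast_pos hn
  rw [Real.rpow_add h0, Real.rpow_neg h0.le]
  field_simp

/-- The lower and upper limits in the first part are taken in the extended reals. -/
theorem proposition5p1 {Ω : Type*} [MeasurableSpace Ω] (P : Measure Ω) [IsProbabilityMeasure P]
    (α β δ : ℝ) (hβ : β ≠ 0) (hδ : 0 < δ) (p : ℕ → Ω → ℝ)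
    (hp : IsBetaEnvironment P (initialWeight α β) δ p) :
    (α < 0 → ∀ᵐ ω ∂P, ∀ ε : ℝ, 0 < ε → ε < 1 / |β| →
      (((2 * δ - ε / 2) / (1 - α - ε * |β|) : ℝ) : EReal) ≤
          liminf (fun x : ℕ =>
            ((logResistance p x ω / (x : ℝ) ^ (1 - α - ε * |β|) : ℝ) : EReal)) atTop ∧
        limsup (fun x : ℕ =>
            ((logResistance p x ω / (x : ℝ) ^ (1 - α + ε * |β|) : ℝ) : EReal)) atTop ≤
          (((2 * δ + ε / 2) / (1 - α + ε * |β|) : ℝ) : EReal)) ∧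
    (0 ≤ α → α < 1 → ∀ᵐ ω ∂P,
      Tendsto (fun x : ℕ =>
          logResistance p x ω / ((x : ℝ) ^ (1 - α) * Real.log x ^ (-β)))
        atTop (𝓝 (1 / asympConst α β δ))) ∧
    (α = 1 → β < 0 → ∀ᵐ ω ∂P,
      Tendsto (fun x : ℕ => logResistance p x ω / Real.log x ^ (1 - β))
        atTop (𝓝 (δ / (1 - β)))) ∧
    (α = 1 → 0 < β → β ≤ 1 → ∀ᵐ ω ∂P,
      Tendsto (fun x : ℕ => logResistance p x ω / Real.log x) atTop (𝓝 (-1))) := by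
  refine ⟨fun hα => ?_, fun hα0 hα1 => ?_, fun hα hβ0 => ?_, fun hα hβ0 _ => ?_⟩
  · filter_upwards [ae_tendsto_logResistance_of_initialWeight_tendsto_zero hp hδ (by linarith)
      (tendsto_initialWeight_zero (Or.inl hα))] with ω hω ε hε hε1
    have hα' : 0 < 1 - α := by linarith
    have hs : 0 < ε * |β| := mul_pos hε (abs_pos.2 hβ)
    -- The first quotient tends to `+∞` and the second to 0, so any finite lower bound and any
    -- positive upper bound hold eventually.
    constructor
    · refine le_liminf_of_le (by isBoundedDefault) ?_
      filter_upwards [(tendsto_div_rpow_sub_atTop (by positivity) hs hω).eventually_ge_atTop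
        ((2 * δ - ε / 2) / (1 - α - ε * |β|))] with n hn
      exact EReal.coe_le_coe_iff.2 hn
    · refine limsup_le_of_le (by isBoundedDefault) ?_
      filter_upwards [(tendsto_div_rpow_add_zero hs hω).eventually_le_const
        (show 0 < (2 * δ + ε / 2) / (1 - α + ε * |β|) by positivity)] with n hn
      exact EReal.coe_le_coe_iff.2 hn
  · rcases hα0.eq_or_lt with rfl | hα0
    · rcases hβ.lt_or_gt with hβ0 | hβ0
      · have h := ae_tendsto_logResistance_of_initialWeight_tendsto_zero hp hδ hα1
          (tendsto_initialWeight_zero (Or.inr ⟨rfl, hβ0⟩))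
        simpa [asympConst, hβ0] using h
      · have h := ae_tendsto_logResistance_of_initialWeight_tendsto_atTop hp hδ hα1
          (tendsto_initialWeight_atTop (Or.inr ⟨rfl, hβ0⟩))
        simpa [asympConst, hβ0.not_gt] using h
    · have h := ae_tendsto_logResistance_of_initialWeight_tendsto_atTop hp hδ hα1
        (tendsto_initialWeight_atTop (Or.inl hα0))
      simpa [asympConst, hα0.not_gt, hα0.ne'] using h
  · subst hα
    exact ae_tendsto_logResistance_div_log_rpow hp hδ hβ0
  · subst hα
    exact ae_tendsto_logResistance_div_log hp hδ hβ0
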